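/- Let $n\ge 1$, let $\mathbb F_n^+$ be the free unital semigroup on generators $g_1,\dots,g_n$ with identity $g_0$, and let $|\alpha|$ be the length of $\alpha\in\mathbb F_n^+$. For operators $T_1,\dots,T_n$ put $T_\alpha=T_{i_1}\cdots T_{i_k}$ if $\alpha=g_{i_1}\cdots g_{i_k}$, and $T_{g_0}=I$. Hilbert spaces are complex, $\otimes$ is the Hilbert space tensor product, and $S_1,\dots,S_n$ are the left creation operators $S_i\varphi=e_i\otimes\varphi$ on the full Fock space $F^2(H_n)=\bigoplus_{k\ge 0}H_n^{\otimes k}$, where $H_n$ is a Hilbert space with orthonormal basis $e_1,\dots,e_n$. Let $\mathcal H$ be a Hilbert space and let $\{A_{(\alpha)}\}_{\alpha\in\mathbb F_n^+}\subset B(\mathcal H)$ be such that for every Hilbert space $\mathcal X$ and every $(X_1,\dots,X_n)\in B(\mathcal X)^n$ with $\|X_1X_1^*+\cdots+X_nX_n^*\|<1$ the series $$F(X_1,\dots,X_n)=\sum_{k=0}^\infty\ \sum_{|\alpha|=k}X_\alpha\otimes A_{(\alpha)}$$ converges in the operator norm (that is, the partial sums over $k$ converge). Write $A_{(0)}=A_{(g_0)}$.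 Suppose that $F(0)\ge 0$ and that $\operatorname{Re}F(X_1,\dots,X_n)\le I$ for all such $\mathcal X$ and $(X_1,\dots,X_n)$. Then: (i) For every $k\ge 1$ the operator matrix $$P_k=\begin{pmatrix}2(I-A_{(0)}) & [A_{(\alpha)}^*:|\alpha|=k]\\ \left[\begin{matrix}A_{(\alpha)}\\ \vdots\\ |\alpha|=k\end{matrix}\right] & \operatorname{diag}\bigl(2(I-A_{(0)}),\dots,2(I-A_{(0)})\bigr)\end{pmatrix},$$ acting on the direct sum of $1+n^k$ copies of $\mathcal H$, is positive. (ii) If $\mathcal K$ is a Hilbert space and $\{Y_{(\alpha)}\}_{\alpha\in\mathbb F_n^+}\subset B(\mathcal K)$ satisfies $$\|Y_{(g_0)}\|\le 1\quad\text{and}\quad \sum_{k=1}^\infty\Bigl\|\sum_{|\alpha|=k}Y_{(\alpha)}^*Y_{(\alpha)}\Bigr\|^{1/2}\le\frac12,$$ then the series $\sum_{k=0}^\infty\sum_{|\alpha|=k}S_\alpha\otimes A_{(\alpha)}\otimes Y_{(\alpha)}$ converges in the norm of $B(F^2(H_n)\otimes\mathcal H\otimes\mathcal K)$, and $$\Bigl\|\sum_{k=0}^\infty\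 \sum_{|\alpha|=k}S_\alpha\otimes A_{(\alpha)}\otimes Y_{(\alpha)}\Bigr\|\le 1.$$ -/

import Mathlib

open Filter Topology
open scoped TensorProduct

universe w u v

noncomputable section

namespace FreeHolo

/-- The Hilbert space tensor product: the completion of the algebraic tensor product with the inner
product `⟪x ⊗ y, x' ⊗ y'⟫ = ⟪x, x'⟫ * ⟪y, y'⟫`. -/
abbrev HTensor (E F : Type*) [NormedAddCommGroup E] [InnerProductSpace ℂ E]
    [NormedAddCommGroup F] [InnerProductSpace ℂ F] : Type _ :=
  UniformSpace.Completion (E ⊗[ℂ] F)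

/-- The tensor product `T ⊗ A` of bounded operators, acting on the Hilbert tensor product. -/
def opTensor {E F : Type*} [NormedAddCommGroup E] [InnerProductSpace ℂ E]
    [NormedAddCommGroup F] [InnerProductSpace ℂ F] (T : E →L[ℂ] E) (A : F →L[ℂ] F) :
    HTensor E F →L[ℂ] HTensor E F :=
  (TensorProduct.mapL T A).completion

theorem opTensor_tmul {E F : Type*} [NormedAddCommGroup E] [InnerProductSpace ℂ E]
    [NormedAddCommGroup F] [InnerProductSpace ℂ F] (T : E →L[ℂ] E) (A : F →L[ℂ] F)
    (x : E) (y : F) :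
    opTensor T A ((x ⊗ₜ[ℂ] y : E ⊗[ℂ] F) : HTensor E F)
      = ((T x ⊗ₜ[ℂ] A y : E ⊗[ℂ] F) : HTensor E F) := by
  simp [opTensor]

/-- The free semigroup `𝔽ₙ⁺` on `n` generators; its identity `g₀` is `1`, and the length `|α|` is
`FreeMonoid.length`. -/
abbrev Words (n : ℕ) : Type := FreeMonoid (Fin n)

instance instDecidableEqWords (n : ℕ) : DecidableEq (Words n) :=
  inferInstanceAs (DecidableEq (List (Fin n)))

/-- The finite set of the words `α` with `|α| = k`. -/
def wordsOfLength (n k : ℕ) : Finset (Words n) :=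
  Finset.univ.map ⟨fun v : List.Vector (Fin n) k => FreeMonoid.ofList v.toList,
    fun _ _ h => Subtype.ext h⟩

theorem mem_wordsOfLength {n k : ℕ} {α : Words n} : α ∈ wordsOfLength n k ↔ α.length = k := by
  simp only [wordsOfLength, Finset.mem_map, Finset.mem_univ, true_and]
  constructor
  · rintro ⟨v, rfl⟩
    exact v.2
  · intro h
    exact ⟨⟨FreeMonoid.toList α, h⟩, rfl⟩

/-- The product `T_α = T_{i₁} T_{i₂} ⋯ T_{iₖ}` for `α = g_{i₁} g_{i₂} ⋯ g_{iₖ}`, with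
`T_{g₀} = I`. -/
def wordProd {n : ℕ} {X : Type*} [NormedAddCommGroup X] [InnerProductSpace ℂ X]
    (T : Fin n → X →L[ℂ] X) (α : Words n) : X →L[ℂ] X :=
  FreeMonoid.lift T α

/-- The full Fock space `F²(Hₙ)` of an `n`-dimensional Hilbert space with orthonormal basis
`e₁, …, eₙ`, in the coordinates given by the orthonormal basis
`e_α = e_{i₁} ⊗ ⋯ ⊗ e_{iₖ}`, `α = g_{i₁} ⋯ g_{iₖ} ∈ 𝔽ₙ⁺`. -/
abbrev Fock (n : ℕ) : Type := lp (fun _ : Words n => ℂ) 2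

/-- The basis vector `e_α` of the full Fock space. -/
def fockBasis {n : ℕ} (α : Words n) : Fock n := lp.single 2 α (1 : ℂ)

theorem orthonormal_fockBasis (n : ℕ) : Orthonormal ℂ (fockBasis (n := n)) := by
  rw [orthonormal_iff_ite]
  intro α β
  simp only [fockBasis]
  rw [lp.inner_single_left]
  by_cases h : α = β
  · subst h; simp
  · simp [h]

theorem orthonormal_fockBasis_mul {n : ℕ} (i : Fin n) :
    Orthonormal ℂ (fun β : Words n => fockBasis (FreeMonoid.of i * β)) :=
  (orthonormal_fockBasis n).comp _ (mul_right_injective _)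

/-- The left creation operator `S_i φ = e_i ⊗ φ` on the full Fock space, i.e. the isometry
`∑ φ_β e_β ↦ ∑ φ_β e_{g_i β}`. -/
def leftCreation {n : ℕ} (i : Fin n) : Fock n →L[ℂ] Fock n :=
  ((orthonormal_fockBasis_mul i).orthogonalFamily.linearIsometry).toContinuousLinearMap

theorem leftCreation_fockBasis {n : ℕ} (i : Fin n) (β : Words n) :
    leftCreation i (fockBasis β) = fockBasis (FreeMonoid.of i * β) := by
  simp [leftCreation, fockBasis, OrthogonalFamily.linearIsometry_apply_single]

/-- The partial sum `∑_{k < m} ∑_{|α| = k} X_α ⊗ A_(α)`. -/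
def partialSum {n : ℕ} {H : Type*} [NormedAddCommGroup H] [InnerProductSpace ℂ H]
    (A : Words n → H →L[ℂ] H) {X : Type*} [NormedAddCommGroup X] [InnerProductSpace ℂ X]
    (T : Fin n → X →L[ℂ] X) (m : ℕ) : HTensor X H →L[ℂ] HTensor X H :=
  ∑ k ∈ Finset.range m, ∑ α ∈ wordsOfLength n k, opTensor (wordProd T α) (A α)

/-- `T ∈ [B(X)ⁿ]_{<1}`, the open unit ball `‖X₁X₁* + ⋯ + XₙXₙ*‖ < 1`. -/
def InBall {n : ℕ} {X : Type*} [NormedAddCommGroup X] [InnerProductSpace ℂ X] [CompleteSpace X]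
    (T : Fin n → X →L[ℂ] X) : Prop :=
  ‖∑ i, T i * star (T i)‖ < 1

/-- The coefficients `A_(α)` define a (universal) holomorphic function on `[B(X)ⁿ]_{<1}`: for every
Hilbert space `X` and every tuple in the ball, the series
`∑_k ∑_{|α| = k} X_α ⊗ A_(α)` converges in the operator norm. -/
def IsHolomorphic {n : ℕ} {H : Type u} [NormedAddCommGroup H] [InnerProductSpace ℂ H]
    (A : Words n → H →L[ℂ] H) : Prop :=
  ∀ (X : Type w) [NormedAddCommGroup X] [InnerProductSpace ℂ X] [CompleteSpace X]
    (T : Fin n → X →L[ℂ] X), InBall T →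
      ∃ L : HTensor X H →L[ℂ] HTensor X H, Tendsto (partialSum A T) atTop (𝓝 L)

/-- The value `F(X₁, …, Xₙ) = ∑_k ∑_{|α| = k} X_α ⊗ A_(α)`, the operator norm limit of the partial
sums (meaningful where the series converges). -/
def eval {n : ℕ} {H : Type*} [NormedAddCommGroup H] [InnerProductSpace ℂ H]
    (A : Words n → H →L[ℂ] H) {X : Type*} [NormedAddCommGroup X] [InnerProductSpace ℂ X]
    (T : Fin n → X →L[ℂ] X) : HTensor X H →L[ℂ] HTensor X H :=
  limUnder atTop (partialSum A T)

theorem IsHolomorphic.tendsto_eval {n : ℕ} {H : Type u} [NormedAddCommGroup H]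
    [InnerProductSpace ℂ H] {A : Words n → H →L[ℂ] H} (hA : IsHolomorphic.{w} A)
    (X : Type w) [NormedAddCommGroup X] [InnerProductSpace ℂ X] [CompleteSpace X]
    (T : Fin n → X →L[ℂ] X) (hT : InBall T) :
    Tendsto (partialSum A T) atTop (𝓝 (eval A T)) :=
  tendsto_nhds_limUnder (hA X T hT)

/-- The operator on the Hilbert direct sum `⨁_{i ∈ ι} H` given by an operator matrix:
`(M x)_i = ∑_j M_{ij} x_j`. -/
def blockOp {ι : Type*} [Fintype ι] {H : Type*} [NormedAddCommGroup H] [InnerProductSpace ℂ H]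
    (M : Matrix ι ι (H →L[ℂ] H)) :
    PiLp 2 (fun _ : ι => H) →L[ℂ] PiLp 2 (fun _ : ι => H) :=
  (PiLp.continuousLinearEquiv 2 ℂ (fun _ : ι => H)).symm.toContinuousLinearMap ∘L
    ContinuousLinearMap.pi fun i => ∑ j, M i j ∘L PiLp.proj 2 (fun _ : ι => H) j

theorem blockOp_apply {ι : Type*} [Fintype ι] {H : Type*} [NormedAddCommGroup H]
    [InnerProductSpace ℂ H] (M : Matrix ι ι (H →L[ℂ] H)) (x : PiLp 2 (fun _ : ι => H)) (i : ι) :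
    blockOp M x i = ∑ j, M i j (x j) := by
  simp [blockOp]

/-- The operator matrix `P_k`: diagonal entries `2(I - A_(0))`, first row
`[A_(α)* : |α| = k]`, first column `[A_(α) : |α| = k]`, all other entries `0`. -/
def matP {n : ℕ} {H : Type*} [NormedAddCommGroup H] [InnerProductSpace ℂ H] [CompleteSpace H]
    (A : Words n → H →L[ℂ] H) (k : ℕ) :
    Matrix (Unit ⊕ wordsOfLength n k) (Unit ⊕ wordsOfLength n k) (H →L[ℂ] H) :=
  Matrix.fromBlocks
    (Matrix.of fun _ _ => (2 : ℂ) • (1 - A 1))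
    (Matrix.of fun _ α => star (A α))
    (Matrix.of fun α _ => A α)
    (Matrix.of fun α β => if α = β then (2 : ℂ) • (1 - A 1) else 0)

end FreeHolo

end

/-! The hypothesis is tested on `X_i = r S_i`, `0 ≤ r < 1`, transported to an ℓ² space of the
required universe. In the basis `e_μ`, the entry of `F(rS)` from `e_ν` to `e_{αν}` is `r^{|α|}
A_(α)`, and every entry from `e_ν` to a word not ending in `ν` vanishes. Evaluating `Re F ≤ I` at
`e_1 ⊗ h + ∑_{|μ|=k} e_μ ⊗ x_μ` and letting `r → 1` gives a scalar inequality (`re_inner_coeff_le`).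
After `x ↦ -x` this is the positivity of `P_k`, since `F(0) ≥ 0` makes `A_(0)` positive.

For (ii), the inequality with a single nonzero `x_μ` yields `A_(α) = D G_α D` with `‖G_α‖ ≤ 1` and
`D² = 2(I - A_(0)) + ε` (`exists_factorization`). The `S_α` of one length have orthogonal ranges, so
the degree `k` part is `Q Z_k Q` with `Q = I ⊗ D ⊗ I` and `‖Z_k‖ ≤ ‖∑ Y_α* Y_α‖^{1/2}`
(`norm_homogeneousPart_le`); hence the series converges. The degree `0` part is `R C R` with `R = I
⊗ A_(0)^{1/2} ⊗ I` and `‖C‖ ≤ 1`. Since `R² + Q²/2 = (1 + ε/2) I` and `∑ ‖Z_k‖ ≤ 1/2`, the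
arithmetic-geometric mean inequality bounds the sum by `1 + ε/2` (`norm_sandwich_add_le`), and `ε`
is arbitrary. -/

noncomputable section

namespace FreeHolo

/-! ### Tensor products of operators: algebra, adjoint, norm, order -/

section opTensor

variable {E F : Type*} [NormedAddCommGroup E] [InnerProductSpace ℂ E]
  [NormedAddCommGroup F] [InnerProductSpace ℂ F]

/-- Bounded operators on the Hilbert tensor product agree if they agree on elementary tensors. -/
theorem HTensor.clm_ext {G : Type*} [NormedAddCommGroup G] [NormedSpace ℂ G]
    {S T : HTensor E F →L[ℂ] G}
    (h : ∀ (x : E) (y : F), S ((x ⊗ₜ[ℂ] y : E ⊗[ℂ] F) : HTensor E F)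
      = T ((x ⊗ₜ[ℂ] y : E ⊗[ℂ] F) : HTensor E F)) : S = T := by
  ext z
  induction z using UniformSpace.Completion.induction_on with
  | hp => exact isClosed_eq S.continuous T.continuous
  | ih z =>
    induction z using TensorProduct.induction_on with
    | zero => rw [UniformSpace.Completion.coe_zero, map_zero, map_zero]
    | tmul x y => exact h x y
    | add a b ha hb => rw [UniformSpace.Completion.coe_add, map_add, map_add, ha, hb]

theorem inner_tmul_coe (x x' : E) (y y' : F) :
    inner ℂ ((x ⊗ₜ[ℂ] y : E ⊗[ℂ] F) : HTensor E F) ((x' ⊗ₜ[ℂ] y' : E ⊗[ℂ] F) : HTensor E F)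
      = inner ℂ x x' * inner ℂ y y' := by
  rw [UniformSpace.Completion.inner_coe, TensorProduct.inner_tmul]

theorem opTensor_mul (S T : E →L[ℂ] E) (A B : F →L[ℂ] F) :
    opTensor (S * T) (A * B) = opTensor S A * opTensor T B :=
  HTensor.clm_ext fun x y => by simp [opTensor_tmul]

@[simp]
theorem opTensor_one : opTensor (1 : E →L[ℂ] E) (1 : F →L[ℂ] F) = 1 :=
  HTensor.clm_ext fun x y => by simp [opTensor_tmul]

theorem opTensor_add_left (S T : E →L[ℂ] E) (A : F →L[ℂ] F) :
    opTensor (S + T) A = opTensor S A + opTensor T A :=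
  HTensor.clm_ext fun x y => by simp [opTensor_tmul, TensorProduct.add_tmul, UniformSpace.Completion.coe_add]

theorem opTensor_add_right (S : E →L[ℂ] E) (A B : F →L[ℂ] F) :
    opTensor S (A + B) = opTensor S A + opTensor S B :=
  HTensor.clm_ext fun x y => by simp [opTensor_tmul, TensorProduct.tmul_add, UniformSpace.Completion.coe_add]

theorem opTensor_smul_left (c : ℂ) (S : E →L[ℂ] E) (A : F →L[ℂ] F) :
    opTensor (c • S) A = c • opTensor S A :=
  HTensor.clm_ext fun x y => by
    simp [opTensor_tmul, ← TensorProduct.smul_tmul', UniformSpace.Completion.coe_smul]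

theorem opTensor_smul_right (c : ℂ) (S : E →L[ℂ] E) (A : F →L[ℂ] F) :
    opTensor S (c • A) = c • opTensor S A :=
  HTensor.clm_ext fun x y => by simp [opTensor_tmul, UniformSpace.Completion.coe_smul]

@[simp]
theorem opTensor_zero_left (A : F →L[ℂ] F) : opTensor (0 : E →L[ℂ] E) A = 0 := by
  simpa using opTensor_smul_left 0 (0 : E →L[ℂ] E) A

@[simp]
theorem opTensor_zero_right (S : E →L[ℂ] E) : opTensor S (0 : F →L[ℂ] F) = 0 := by
  simpa using opTensor_smul_right 0 S (0 : F →L[ℂ] F)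

theorem opTensor_sub_left (S T : E →L[ℂ] E) (A : F →L[ℂ] F) :
    opTensor (S - T) A = opTensor S A - opTensor T A := by
  rw [eq_sub_iff_add_eq, ← opTensor_add_left, sub_add_cancel]

theorem opTensor_sub_right (S : E →L[ℂ] E) (A B : F →L[ℂ] F) :
    opTensor S (A - B) = opTensor S A - opTensor S B := by
  rw [eq_sub_iff_add_eq, ← opTensor_add_right, sub_add_cancel]

theorem opTensor_sum_right {ι : Type*} (s : Finset ι) (S : E →L[ℂ] E) (A : ι → F →L[ℂ] F) :
    opTensor S (∑ i ∈ s, A i) = ∑ i ∈ s, opTensor S (A i) := by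
  classical
  induction s using Finset.induction_on with
  | empty => simp
  | insert a s ha ih => rw [Finset.sum_insert ha, Finset.sum_insert ha, opTensor_add_right, ih]

theorem norm_opTensor_le (S : E →L[ℂ] E) (A : F →L[ℂ] F) : ‖opTensor S A‖ ≤ ‖S‖ * ‖A‖ := by
  refine ContinuousLinearMap.opNorm_le_bound _ (by positivity) fun z => ?_
  induction z using UniformSpace.Completion.induction_on with
  | hp => exact isClosed_le (by fun_prop) (by fun_prop)
  | ih z =>
    rw [opTensor, ContinuousLinearMap.completion_apply_coe, UniformSpace.Completion.norm_coe,
      UniformSpace.Completion.norm_coe]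
    exact (TensorProduct.mapL S A).le_of_opNorm_le (TensorProduct.norm_mapL_le S A) z

theorem star_opTensor [CompleteSpace E] [CompleteSpace F] (S : E →L[ℂ] E) (A : F →L[ℂ] F) :
    star (opTensor S A) = opTensor (star S) (star A) := by
  refine HTensor.clm_ext fun x y => ?_
  refine ext_inner_right ℂ fun z => ?_
  rw [ContinuousLinearMap.star_eq_adjoint, ContinuousLinearMap.adjoint_inner_left]
  -- Both sides are bounded functionals of `z`, so elementary tensors suffice.
  have key : (innerSL ℂ ((x ⊗ₜ[ℂ] y : E ⊗[ℂ] F) : HTensor E F)).comp (opTensor S A)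
      = innerSL ℂ (opTensor (star S) (star A) ((x ⊗ₜ[ℂ] y : E ⊗[ℂ] F) : HTensor E F)) := by
    refine HTensor.clm_ext fun x' y' => ?_
    simp only [ContinuousLinearMap.comp_apply, innerSL_apply_apply, opTensor_tmul, inner_tmul_coe,
      ContinuousLinearMap.star_eq_adjoint, ContinuousLinearMap.adjoint_inner_left]
  simpa using DFunLike.congr_fun key z

variable [CompleteSpace E] [CompleteSpace F]

theorem opTensor_nonneg {S : E →L[ℂ] E} {A : F →L[ℂ] F} (hS : 0 ≤ S) (hA : 0 ≤ A) :
    0 ≤ opTensor S A := by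
  obtain ⟨P, rfl⟩ := CStarAlgebra.nonneg_iff_eq_star_mul_self.mp hS
  obtain ⟨Q, rfl⟩ := CStarAlgebra.nonneg_iff_eq_star_mul_self.mp hA
  rw [opTensor_mul, ← star_opTensor]
  exact star_mul_self_nonneg (opTensor P Q)

theorem opTensor_le_opTensor_left {S T : E →L[ℂ] E} {A : F →L[ℂ] F} (h : S ≤ T) (hA : 0 ≤ A) :
    opTensor S A ≤ opTensor T A := by
  rw [← sub_nonneg, ← opTensor_sub_left]
  exact opTensor_nonneg (sub_nonneg.mpr h) hA

theorem opTensor_le_opTensor_right {S : E →L[ℂ] E} {A B : F →L[ℂ] F} (hS : 0 ≤ S) (h : A ≤ B) :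
    opTensor S A ≤ opTensor S B := by
  rw [← sub_nonneg, ← opTensor_sub_right]
  exact opTensor_nonneg hS (sub_nonneg.mpr h)

end opTensor

/-! ### Left creation operators -/

section creation

variable {n : ℕ}

theorem fock_clm_ext {G : Type*} [NormedAddCommGroup G] [NormedSpace ℂ G] {S T : Fock n →L[ℂ] G}
    (h : ∀ α, S (fockBasis α) = T (fockBasis α)) : S = T := by
  refine lp.ext_continuousLinearMap (by norm_num) fun α => ?_
  ext
  exact h α

theorem inner_fockBasis (α β : Words n) :
    inner ℂ (fockBasis α) (fockBasis β) = if α = β then 1 else (0 : ℂ) :=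
  orthonormal_iff_ite.mp (orthonormal_fockBasis n) α β

theorem wordProd_one {X : Type*} [NormedAddCommGroup X] [InnerProductSpace ℂ X]
    (T : Fin n → X →L[ℂ] X) : wordProd T 1 = 1 := map_one _

theorem wordProd_of_mul {X : Type*} [NormedAddCommGroup X] [InnerProductSpace ℂ X]
    (T : Fin n → X →L[ℂ] X) (i : Fin n) (α : Words n) :
    wordProd T (FreeMonoid.of i * α) = T i * wordProd T α := by
  simp [wordProd]

theorem inner_fockBasis_left (α : Words n) (z : Fock n) : inner ℂ (fockBasis α) z = z α := by
  rw [fockBasis, lp.inner_single_left]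
  simp

theorem fock_clm_ext_inner {S T : Fock n →L[ℂ] Fock n}
    (h : ∀ α β, inner ℂ (fockBasis α) (S (fockBasis β)) = inner ℂ (fockBasis α) (T (fockBasis β))) :
    S = T := by
  refine fock_clm_ext fun β => lp.ext <| funext fun α => ?_
  rw [← inner_fockBasis_left, ← inner_fockBasis_left, h]

theorem of_mul_inj {i j : Fin n} {α β : Words n} :
    FreeMonoid.of i * α = FreeMonoid.of j * β ↔ i = j ∧ α = β :=
  List.cons_eq_cons

theorem star_leftCreation_mul_leftCreation (i j : Fin n) :
    star (leftCreation i) * leftCreation j = if i = j then 1 else 0 := by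
  refine fock_clm_ext_inner fun α β => ?_
  rw [mul_apply_eq_comp, ContinuousLinearMap.star_eq_adjoint,
    ContinuousLinearMap.adjoint_inner_right, leftCreation_fockBasis, leftCreation_fockBasis,
    inner_fockBasis]
  by_cases h : i = j
  · subst h
    simp [inner_fockBasis]
  · simp [h, of_mul_inj]

/-- The relation `S_i* S_j = δ_ij` cancels first letters one by one. Equal length matters: if one
word is a proper prefix of the other, the product is a nonzero creation operator or its adjoint. -/
theorem star_wordProd_leftCreation_mul {α β : Words n} (h : α.length = β.length) :
    star (wordProd leftCreation α) * wordProd leftCreation β = if α = β then 1 else 0 := by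
  induction α using FreeMonoid.inductionOn' generalizing β with
  | one =>
    have hβ : β = 1 := by simpa [eq_comm] using h
    simp [hβ, wordProd_one]
  | of_mul i α ih =>
    cases β using FreeMonoid.casesOn with
    | one => simp at h
    | of_mul j β =>
      have hl : α.length = β.length := by simpa using h
      rw [wordProd_of_mul, wordProd_of_mul, star_mul, mul_assoc, ← mul_assoc (star (leftCreation i)),
        star_leftCreation_mul_leftCreation]
      by_cases hij : i = j
      · simp [hij, ih hl]
      · simp [hij, of_mul_inj]

end creation

/-! ### Matrix coefficients of `F` at scaled creation operators -/

section compressedCreation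

variable {n : ℕ} {E : Type*} [NormedAddCommGroup E] [InnerProductSpace ℂ E] [CompleteSpace E]

/-- The operators `r V S_i V*` on a Hilbert space that contains an isometric copy of the full Fock
space. -/
def scaledCreation (V : Fock n →ₗᵢ[ℂ] E) (r : ℝ) (i : Fin n) : E →L[ℂ] E :=
  (r : ℂ) • (V.toContinuousLinearMap ∘L leftCreation i ∘L V.toContinuousLinearMap.adjoint)

theorem adjoint_isometry_apply (V : Fock n →ₗᵢ[ℂ] E) (x : Fock n) :
    V.toContinuousLinearMap.adjoint (V x) = x :=
  ext_inner_right ℂ fun y => by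
    rw [ContinuousLinearMap.adjoint_inner_left]
    exact V.inner_map_map x y

theorem wordProd_scaledCreation_apply (V : Fock n →ₗᵢ[ℂ] E) (r : ℝ) (α β : Words n) :
    wordProd (scaledCreation V r) α (V (fockBasis β))
      = ((r : ℂ) ^ α.length) • V (fockBasis (α * β)) := by
  induction α using FreeMonoid.inductionOn' with
  | one => simp [wordProd_one]
  | of_mul i α ih =>
    rw [wordProd_of_mul, mul_apply_eq_comp, ih, map_smul, mul_assoc, FreeMonoid.length_mul,
      FreeMonoid.length_of, pow_add, pow_one, mul_smul, smul_comm]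
    simp [scaledCreation, adjoint_isometry_apply, leftCreation_fockBasis]

/-- The copies of the `S_i` are partial isometries with orthogonal ranges, so their range
projections add up to a projection, which is then scaled by `r² < 1`. -/
theorem inBall_scaledCreation (V : Fock n →ₗᵢ[ℂ] E) {r : ℝ} (h0 : 0 ≤ r) (h1 : r < 1) :
    InBall (scaledCreation V r) := by
  obtain ⟨C, hC⟩ : ∃ C : Fin n → E →L[ℂ] E, C = fun i =>
    V.toContinuousLinearMap ∘L leftCreation i ∘L V.toContinuousLinearMap.adjoint := ⟨_, rfl⟩
  have hstar : ∀ i, star (C i) =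
      V.toContinuousLinearMap ∘L star (leftCreation i) ∘L V.toContinuousLinearMap.adjoint := by
    intro i
    simp [hC, ContinuousLinearMap.star_eq_adjoint, ContinuousLinearMap.adjoint_comp,
      ContinuousLinearMap.comp_assoc]
  have hmul : ∀ i j, C i * star (C i) * (C j * star (C j))
      = if i = j then C i * star (C i) else 0 := by
    intro i j
    ext x
    have := DFunLike.congr_fun (star_leftCreation_mul_leftCreation i j)
      (star (leftCreation j) (V.toContinuousLinearMap.adjoint x))
    rw [mul_apply_eq_comp] at this
    have hCx : ∀ i x, C i x = V (leftCreation i (V.toContinuousLinearMap.adjoint x)) := by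
      intro i x; rw [hC]; rfl
    simp only [mul_apply_eq_comp, hstar, hCx, ContinuousLinearMap.comp_apply,
      LinearIsometry.coe_toContinuousLinearMap, adjoint_isometry_apply, this]
    split_ifs with h
    · subst h; simp [hCx, adjoint_isometry_apply]
    · simp
  set P := ∑ i, C i * star (C i) with hP
  have hproj : IsStarProjection P := by
    constructor
    · simp only [IsIdempotentElem, hP, Finset.sum_mul, Finset.mul_sum, hmul]
      simp
    · simp [IsSelfAdjoint, hP]
  have hsum : ∑ i, scaledCreation V r i * star (scaledCreation V r i) = ((r ^ 2 : ℝ) : ℂ) • P := by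
    rw [hP, Finset.smul_sum]
    refine Finset.sum_congr rfl fun i _ => ?_
    have : scaledCreation V r i = (r : ℂ) • C i := by rw [hC]; rfl
    rw [this, star_smul, smul_mul_smul_comm]
    simp [pow_two]
  rw [InBall, hsum, norm_smul]
  have := hproj.norm_le
  have hn : ‖((r ^ 2 : ℝ) : ℂ)‖ = r ^ 2 := by simp
  rw [hn]
  nlinarith [norm_nonneg P]

variable {H : Type*} [NormedAddCommGroup H] [InnerProductSpace ℂ H]

theorem inner_partialSum_scaledCreation (A : Words n → H →L[ℂ] H) (V : Fock n →ₗᵢ[ℂ] E) (r : ℝ)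
    (μ ν : Words n) (h h' : H) (m : ℕ) :
    inner ℂ ((V (fockBasis μ) ⊗ₜ[ℂ] h : E ⊗[ℂ] H) : HTensor E H)
      (partialSum A (scaledCreation V r) m ((V (fockBasis ν) ⊗ₜ[ℂ] h' : E ⊗[ℂ] H) : HTensor E H))
      = ∑ k ∈ Finset.range m, ∑ α ∈ wordsOfLength n k,
        if μ = α * ν then (r : ℂ) ^ α.length * inner ℂ h (A α h') else 0 := by
  simp only [partialSum, sum_apply, inner_sum]
  refine Finset.sum_congr rfl fun k _ => Finset.sum_congr rfl fun α _ => ?_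
  rw [opTensor_tmul, inner_tmul_coe, wordProd_scaledCreation_apply, inner_smul_right,
    V.inner_map_map, inner_fockBasis]
  simp

theorem tendsto_inner_apply {ι G : Type*} [NormedAddCommGroup G] [InnerProductSpace ℂ G]
    {l : Filter ι} {S : ι → G →L[ℂ] G} {L : G →L[ℂ] G} (hS : Tendsto S l (𝓝 L)) (x y : G) :
    Tendsto (fun i => inner ℂ x (S i y)) l (𝓝 (inner ℂ x (L y))) :=
  tendsto_const_nhds.inner (((ContinuousLinearMap.apply ℂ G y).continuous.tendsto L).comp hS)

/-- Right cancellation in the free semigroup leaves one nonzero term of the series, so each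
coefficient of `F` can be read off. -/
theorem inner_eval_scaledCreation_mul (A : Words n → H →L[ℂ] H) (V : Fock n →ₗᵢ[ℂ] E) (r : ℝ)
    (hlim : Tendsto (partialSum A (scaledCreation V r)) atTop (𝓝 (eval A (scaledCreation V r))))
    (α ν : Words n) (h h' : H) :
    inner ℂ ((V (fockBasis (α * ν)) ⊗ₜ[ℂ] h : E ⊗[ℂ] H) : HTensor E H)
      (eval A (scaledCreation V r) ((V (fockBasis ν) ⊗ₜ[ℂ] h' : E ⊗[ℂ] H) : HTensor E H))
      = (r : ℂ) ^ α.length * inner ℂ h (A α h') := by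
  have ht := tendsto_inner_apply hlim ((V (fockBasis (α * ν)) ⊗ₜ[ℂ] h : E ⊗[ℂ] H) : HTensor E H)
    ((V (fockBasis ν) ⊗ₜ[ℂ] h' : E ⊗[ℂ] H) : HTensor E H)
  refine tendsto_nhds_unique ht (tendsto_const_nhds.congr' ?_)
  -- The `m`-th partial sum stops at degree `m - 1`, so it contains `α` only for `m > |α|`.
  filter_upwards [eventually_gt_atTop α.length] with m hm
  rw [inner_partialSum_scaledCreation]
  simp only [mul_left_inj]
  rw [Finset.sum_eq_single_of_mem α.length (Finset.mem_range.mpr hm), Finset.sum_ite_eq,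
    if_pos (mem_wordsOfLength.mpr rfl)]
  intro k _ hk
  rw [Finset.sum_ite_eq, if_neg]
  rwa [mem_wordsOfLength, eq_comm]

theorem inner_eval_scaledCreation_eq_zero (A : Words n → H →L[ℂ] H) (V : Fock n →ₗᵢ[ℂ] E) (r : ℝ)
    (hlim : Tendsto (partialSum A (scaledCreation V r)) atTop (𝓝 (eval A (scaledCreation V r))))
    {μ ν : Words n} (hμ : ∀ α, μ ≠ α * ν) (h h' : H) :
    inner ℂ ((V (fockBasis μ) ⊗ₜ[ℂ] h : E ⊗[ℂ] H) : HTensor E H)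
      (eval A (scaledCreation V r) ((V (fockBasis ν) ⊗ₜ[ℂ] h' : E ⊗[ℂ] H) : HTensor E H)) = 0 := by
  have ht := tendsto_inner_apply hlim ((V (fockBasis μ) ⊗ₜ[ℂ] h : E ⊗[ℂ] H) : HTensor E H)
    ((V (fockBasis ν) ⊗ₜ[ℂ] h' : E ⊗[ℂ] H) : HTensor E H)
  refine tendsto_nhds_unique ht (tendsto_const_nhds.congr fun m => ?_)
  rw [inner_partialSum_scaledCreation]
  simp [hμ]

end compressedCreation

/-! ### The coefficient inequality and positivity of `P_k` -/

section positivity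

variable {n : ℕ}

/-- The Fock space lives in the lowest universe, while the hypotheses on `F` range over spaces in
universe `w`; lifting the index set bridges the two. -/
theorem nonempty_isometry_fock (n : ℕ) :
    Nonempty (Fock n →ₗᵢ[ℂ] lp (fun _ : ULift.{w} (Words n) => ℂ) 2) := by
  have ho : Orthonormal ℂ (fun α : Words n =>
      (lp.single 2 (ULift.up α) (1 : ℂ) : lp (fun _ : ULift.{w} (Words n) => ℂ) 2)) := by
    rw [orthonormal_iff_ite]
    intro α β
    rw [lp.inner_single_left]
    by_cases h : α = β
    · subst h; simp
    · simp [h]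
  exact ⟨ho.orthogonalFamily.linearIsometry⟩

theorem re_inner_le_of_realPart_le_one {E : Type*} [NormedAddCommGroup E] [InnerProductSpace ℂ E]
    [CompleteSpace E] {L : E →L[ℂ] E} (hL : (realPart L : E →L[ℂ] E) ≤ 1) (z : E) :
    (inner ℂ z (L z)).re ≤ (inner ℂ z z).re := by
  have h := (ContinuousLinearMap.le_def _ _).mp hL |>.inner_nonneg_right z
  have h2 := (Complex.le_def.mp h).1
  rw [realPart_apply_coe] at h2
  have h3 : inner ℂ z ((star L) z) = (starRingEnd ℂ) (inner ℂ z (L z)) := by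
    rw [ContinuousLinearMap.star_eq_adjoint, ContinuousLinearMap.adjoint_inner_right,
      inner_conj_symm]
  have h4 : inner ℂ z ((1 - ((2⁻¹ : ℝ) • (L + star L))) z)
      = inner ℂ z z - ((2⁻¹ : ℝ) : ℂ) * (inner ℂ z (L z) + (starRingEnd ℂ) (inner ℂ z (L z))) := by
    rw [← h3, ← inner_add_right, ← inner_smul_right, ← inner_sub_right]
    rfl
  rw [h4, Complex.add_conj, ← Complex.ofReal_mul, Complex.sub_re, Complex.ofReal_re,
    Complex.zero_re] at h2
  linarith

theorem inner_apply_self_eq_re {E : Type*} [NormedAddCommGroup E] [InnerProductSpace ℂ E]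
    {T : E →L[ℂ] E} {y : E} (him : (inner ℂ y (T y)).im = 0) :
    inner ℂ (T y) y = ((inner ℂ y (T y)).re : ℂ) := by
  rw [← inner_conj_symm (T y) y]
  apply Complex.ext
  · rw [Complex.conj_re, Complex.ofReal_re]
  · rw [Complex.conj_im, Complex.ofReal_im, him, neg_zero]

variable {H : Type u} [NormedAddCommGroup H] [InnerProductSpace ℂ H]
  {A : Words n → H →L[ℂ] H}

/-- Compressed to the vacuum and the words of length `k`, `F(rS)` is lower triangular: diagonal
`A_(0)`, first column `r^k A_(μ)`, zeros elsewhere. -/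
theorem re_inner_coeff_le_of_lt_one (hA : IsHolomorphic.{w} A)
    (hARe : ∀ (X : Type w) [NormedAddCommGroup X] [InnerProductSpace ℂ X] [CompleteSpace X]
      (T : Fin n → X →L[ℂ] X), InBall T →
        (realPart (eval A T) : HTensor X H →L[ℂ] HTensor X H) ≤ 1)
    {k : ℕ} (hk : 1 ≤ k) (h : H) (x : wordsOfLength n k → H) {r : ℝ} (h0 : 0 ≤ r) (h1 : r < 1) :
    (inner ℂ h (A 1 h)).re + ∑ μ, (inner ℂ (x μ) (A 1 (x μ))).re
      + r ^ k * ∑ μ, (inner ℂ (x μ) (A μ h)).re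
      ≤ (inner ℂ h h).re + ∑ μ, (inner ℂ (x μ) (x μ)).re := by
  obtain ⟨V⟩ := nonempty_isometry_fock.{w} n
  have hb := inBall_scaledCreation V h0 h1
  have hlim := hA.tendsto_eval _ _ hb
  set L := eval A (scaledCreation V r) with hLdef
  let e : Words n → H → HTensor (lp (fun _ : ULift.{w} (Words n) => ℂ) 2) H :=
    fun μ y => ((V (fockBasis μ) ⊗ₜ[ℂ] y : _ ⊗[ℂ] H) : HTensor _ H)
  have hlen : ∀ μ : wordsOfLength n k, (μ : Words n).length = k := fun μ =>
    mem_wordsOfLength.mp μ.2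
  have hne : ∀ μ : wordsOfLength n k, (μ : Words n) ≠ 1 := by
    intro μ hμ
    have := hlen μ
    rw [hμ, FreeMonoid.length_one] at this
    omega
  have e_inner : ∀ μ ν y y', inner ℂ (e μ y) (e ν y') = if μ = ν then inner ℂ y y' else 0 := by
    intro μ ν y y'
    simp only [e]
    rw [inner_tmul_coe, V.inner_map_map, inner_fockBasis]
    simp
  have e_diag : ∀ μ y y', inner ℂ (e μ y) (L (e μ y')) = inner ℂ y (A 1 y') := by
    intro μ y y'
    simpa using inner_eval_scaledCreation_mul A V r hlim 1 μ y y'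
  have e_col : ∀ (μ : wordsOfLength n k) y y',
      inner ℂ (e μ y) (L (e 1 y')) = ((r ^ k : ℝ) : ℂ) * inner ℂ y (A μ y') := by
    intro μ y y'
    simpa [hlen] using inner_eval_scaledCreation_mul A V r hlim μ 1 y y'
  -- A word of length at most `k` that ends in `ν`, `|ν| = k`, must equal `ν`.
  have e_zero : ∀ (μ : Words n) (ν : wordsOfLength n k) y y', μ ≠ ν → μ.length ≤ k →
      inner ℂ (e μ y) (L (e ν y')) = 0 := by
    intro μ ν y y' hμν hl
    refine inner_eval_scaledCreation_eq_zero A V r hlim (fun α hα => hμν ?_) y y'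
    have := congrArg FreeMonoid.length hα
    rw [FreeMonoid.length_mul, hlen] at this
    have hα1 : α = 1 := by rw [← FreeMonoid.length_eq_zero]; omega
    rw [hα, hα1, one_mul]
  have key := re_inner_le_of_realPart_le_one (hARe _ _ hb) (e 1 h + ∑ μ : wordsOfLength n k, e μ (x μ))
  rw [← hLdef] at key
  have hrow : ∀ μ : wordsOfLength n k, inner ℂ (e 1 h) (L (e μ (x μ))) = 0 := fun μ =>
    e_zero 1 μ h (x μ) (hne μ).symm (by simp)
  have hrest : ∀ μ ν : wordsOfLength n k, inner ℂ (e μ (x μ)) (L (e ν (x ν)))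
      = if ν = μ then inner ℂ (x μ) (A 1 (x μ)) else 0 := by
    intro μ ν
    split_ifs with hμν
    · subst hμν; exact e_diag _ _ _
    · exact e_zero _ _ _ _ (fun hh => hμν (Subtype.ext hh.symm)) (hlen μ).le
  have lhs : inner ℂ (e 1 h + ∑ μ : wordsOfLength n k, e μ (x μ))
      (L (e 1 h + ∑ μ : wordsOfLength n k, e μ (x μ)))
      = inner ℂ h (A 1 h) + ∑ μ, inner ℂ (x μ) (A 1 (x μ))
        + ((r ^ k : ℝ) : ℂ) * ∑ μ, inner ℂ (x μ) (A μ h) := by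
    simp only [map_add, map_sum, inner_add_left, inner_add_right, sum_inner, inner_sum, e_diag,
      e_col, hrow, hrest, Finset.mul_sum, Finset.sum_add_distrib]
    simp
    ring
  have rhs : inner ℂ (e 1 h + ∑ μ : wordsOfLength n k, e μ (x μ))
      (e 1 h + ∑ μ : wordsOfLength n k, e μ (x μ))
      = inner ℂ h h + ∑ μ, inner ℂ (x μ) (x μ) := by
    simp only [inner_add_left, inner_add_right, sum_inner, inner_sum, e_inner, hne, (hne _).symm,
      Subtype.coe_inj, if_true, if_false, Finset.sum_const_zero, add_zero, zero_add]
    simp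
  rw [lhs, rhs] at key
  simpa only [Complex.add_re, Complex.re_sum, Complex.re_ofReal_mul] using key

theorem re_inner_coeff_le (hA : IsHolomorphic.{w} A)
    (hARe : ∀ (X : Type w) [NormedAddCommGroup X] [InnerProductSpace ℂ X] [CompleteSpace X]
      (T : Fin n → X →L[ℂ] X), InBall T →
        (realPart (eval A T) : HTensor X H →L[ℂ] HTensor X H) ≤ 1)
    {k : ℕ} (hk : 1 ≤ k) (h : H) (x : wordsOfLength n k → H) :
    (inner ℂ h (A 1 h)).re + ∑ μ, (inner ℂ (x μ) (A 1 (x μ))).re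
      + ∑ μ, (inner ℂ (x μ) (A μ h)).re
      ≤ (inner ℂ h h).re + ∑ μ, (inner ℂ (x μ) (x μ)).re := by
  have hc : Continuous fun r : ℝ => (inner ℂ h (A 1 h)).re + ∑ μ, (inner ℂ (x μ) (A 1 (x μ))).re
      + r ^ k * ∑ μ, (inner ℂ (x μ) (A μ h)).re := by fun_prop
  have ht := (hc.tendsto 1).mono_left (nhdsWithin_le_nhds (s := Set.Iio 1))
  rw [one_pow, one_mul] at ht
  refine le_of_tendsto ht ?_
  filter_upwards [Ioo_mem_nhdsLT (zero_lt_one' ℝ)] with r hr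
  exact re_inner_coeff_le_of_lt_one hA hARe hk h x hr.1.le hr.2

theorem coeff_one_nonneg (hA : IsHolomorphic.{w} A)
    (hA0 : ∀ (X : Type w) [NormedAddCommGroup X] [InnerProductSpace ℂ X] [CompleteSpace X],
      0 ≤ eval A (0 : Fin n → X →L[ℂ] X)) : 0 ≤ A 1 := by
  obtain ⟨V⟩ := nonempty_isometry_fock.{w} n
  have hz : scaledCreation V 0 = 0 := by
    ext i x
    simp [scaledCreation]
  have hlim := hA.tendsto_eval _ _ (inBall_scaledCreation V le_rfl zero_lt_one)
  rw [ContinuousLinearMap.nonneg_iff_isPositive, ContinuousLinearMap.isPositive_iff_complex]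
  intro h
  have hval := inner_eval_scaledCreation_mul A V 0 hlim 1 1 h h
  have hpos := hA0 (lp (fun _ : ULift.{w} (Words n) => ℂ) 2)
  rw [ContinuousLinearMap.nonneg_iff_isPositive] at hpos
  have hnn := hpos.inner_nonneg_right
    ((V (fockBasis 1) ⊗ₜ[ℂ] h : _ ⊗[ℂ] H) : HTensor (lp (fun _ : ULift.{w} (Words n) => ℂ) 2) H)
  rw [← hz] at hnn
  -- The scaling `r = 0` gives `F(0)`; the vacuum entry survives because `0 ^ 0 = 1`.
  rw [mul_one] at hval
  rw [hval, FreeMonoid.length_one, pow_zero, one_mul] at hnn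
  rw [inner_apply_self_eq_re (Complex.le_def.mp hnn).2.symm]
  exact ⟨rfl, (Complex.le_def.mp hnn).1⟩

variable [CompleteSpace H]

/-- The form of `P_k` at `(h, x)` is twice the slack in `re_inner_coeff_le` at `(h, -x)`: the
diagonal terms are even in `x`, the cross terms odd. -/
theorem blockOp_matP_nonneg (hA : IsHolomorphic.{w} A)
    (hA0 : ∀ (X : Type w) [NormedAddCommGroup X] [InnerProductSpace ℂ X] [CompleteSpace X],
      0 ≤ eval A (0 : Fin n → X →L[ℂ] X))
    (hARe : ∀ (X : Type w) [NormedAddCommGroup X] [InnerProductSpace ℂ X] [CompleteSpace X]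
      (T : Fin n → X →L[ℂ] X), InBall T →
        (realPart (eval A T) : HTensor X H →L[ℂ] HTensor X H) ≤ 1)
    {k : ℕ} (hk : 1 ≤ k) : 0 ≤ blockOp (matP A k) := by
  have h1 := coeff_one_nonneg hA hA0
  rw [ContinuousLinearMap.nonneg_iff_isPositive] at h1
  -- Positivity of `A_(0)` makes its form real; `Re F ≤ I` alone controls only the real part.
  have hre : ∀ y : H, inner ℂ (A 1 y) y = ((inner ℂ y (A 1 y)).re : ℂ) := by
    intro y
    exact inner_apply_self_eq_re (Complex.le_def.mp (h1.inner_nonneg_right y)).2.symm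
  have hnn : ∀ y : H, inner ℂ y y = ((inner ℂ y y).re : ℂ) := by
    intro y
    exact inner_apply_self_eq_re (T := 1) (inner_self_im (𝕜 := ℂ) y)
  rw [ContinuousLinearMap.nonneg_iff_isPositive, ContinuousLinearMap.isPositive_iff_complex]
  intro z
  set h := z (Sum.inl ()) with hh
  set x : wordsOfLength n k → H := fun μ => z (Sum.inr μ) with hx
  have hQ : inner ℂ (blockOp (matP A k) z) z = ((2 * ((inner ℂ h h).re + ∑ μ, (inner ℂ (x μ) (x μ)).re
      - ((inner ℂ h (A 1 h)).re + ∑ μ, (inner ℂ (x μ) (A 1 (x μ))).re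
        + ∑ μ, (inner ℂ (-x μ) (A μ h)).re)) : ℝ) : ℂ) := by
    have hcross : ∀ μ, ((2 * (inner ℂ (x μ) (A μ h)).re : ℝ) : ℂ)
        = inner ℂ (star (A μ) (x μ)) h + inner ℂ (A μ h) (x μ) := by
      intro μ
      rw [ContinuousLinearMap.star_eq_adjoint, ContinuousLinearMap.adjoint_inner_left,
        ← inner_conj_symm (A μ h), Complex.add_conj]
      
    have hdiag : ∀ y : H, inner ℂ (((2 : ℂ) • (1 - A 1)) y) y
        = ((2 * ((inner ℂ y y).re - (inner ℂ y (A 1 y)).re) : ℝ) : ℂ) := by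
      intro y
      rw [Complex.ofReal_mul, Complex.ofReal_sub, ← hre, ← hnn]
      change inner ℂ ((2 : ℂ) • (y - A 1 y)) y = _
      rw [inner_smul_left, inner_sub_left, map_ofNat, Complex.ofReal_ofNat]
    rw [PiLp.inner_apply, Fintype.sum_sum_type]
    simp only [blockOp_apply, Fintype.sum_sum_type, matP, Matrix.fromBlocks_apply₁₁,
      Matrix.fromBlocks_apply₁₂, Matrix.fromBlocks_apply₂₁, Matrix.fromBlocks_apply₂₂,
      Matrix.of_apply, inner_add_left, sum_inner, Finset.univ_unique, Finset.sum_singleton]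
    have hoff : ∀ μ : wordsOfLength n k, ∑ ν : wordsOfLength n k,
        inner ℂ ((if μ = ν then (2 : ℂ) • (1 - A 1) else 0 : H →L[ℂ] H) (z (Sum.inr ν))) (z (Sum.inr μ))
        = inner ℂ (((2 : ℂ) • (1 - A 1)) (x μ)) (x μ) := by
      intro μ
      rw [Finset.sum_eq_single μ]
      · simp [hx]
      · intro ν _ hν
        simp [hν.symm]
      · simp
    simp only [hoff, Finset.sum_add_distrib]
    rw [hdiag]
    simp only [hdiag]
    have hc := Finset.sum_congr rfl fun μ (_ : μ ∈ Finset.univ) => hcross μ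
    rw [Finset.sum_add_distrib] at hc
    simp only [hx] at hc ⊢
    have hinl : z (Sum.inl default) = h := rfl
    rw [hinl]
    simp only [inner_neg_left, Complex.neg_re, Finset.sum_neg_distrib]
    push_cast at hc ⊢
    simp only [← Finset.mul_sum, Finset.sum_sub_distrib] at hc ⊢
    linear_combination -hc
  rw [hQ]
  refine ⟨by simp, ?_⟩
  have := re_inner_coeff_le hA hARe hk h (-x)
  simp only [Pi.neg_apply, map_neg, inner_neg_neg] at this
  have h2 : 0 ≤ (inner ℂ h h).re + ∑ μ, (inner ℂ (x μ) (x μ)).re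
      - ((inner ℂ h (A 1 h)).re + ∑ μ, (inner ℂ (x μ) (A 1 (x μ))).re
        + ∑ μ, (inner ℂ (-x μ) (A μ h)).re) := sub_nonneg.mpr this
  simpa using h2

end positivity

/-! ### Norm bounds from quadratic forms -/

section hilbert

variable {E : Type*} [NormedAddCommGroup E] [InnerProductSpace ℂ E]

theorem norm_le_of_re_inner_le {T : E →L[ℂ] E} {M : ℝ} (hM : 0 < M)
    (h : ∀ x y : E, (inner ℂ y (T x)).re ≤ M / 2 * (‖x‖ ^ 2 + ‖y‖ ^ 2)) : ‖T‖ ≤ M := by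
  refine ContinuousLinearMap.opNorm_le_bound _ hM.le fun x => ?_
  -- The choice `y = M⁻¹ T x` is optimal when `‖T x‖ = M ‖x‖`.
  have h1 := h x (((M⁻¹ : ℝ) : ℂ) • T x)
  have h2 : inner ℂ (T x) (T x) = ((‖T x‖ ^ 2 : ℝ) : ℂ) := by simp [inner_self_eq_norm_sq_to_K]
  rw [inner_smul_left, Complex.conj_ofReal, h2, ← Complex.ofReal_mul, Complex.ofReal_re, norm_smul,
    Complex.norm_real, Real.norm_of_nonneg (inv_nonneg.mpr hM.le), mul_pow] at h1
  have h3 : M⁻¹ * ‖T x‖ ^ 2 * M ≤ M / 2 * (‖x‖ ^ 2 + M⁻¹ ^ 2 * ‖T x‖ ^ 2) * M :=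
    mul_le_mul_of_nonneg_right h1 hM.le
  have h4 : M⁻¹ * ‖T x‖ ^ 2 * M = ‖T x‖ ^ 2 := by field_simp
  have h5 : M / 2 * (‖x‖ ^ 2 + M⁻¹ ^ 2 * ‖T x‖ ^ 2) * M = (M * ‖x‖) ^ 2 / 2 + ‖T x‖ ^ 2 / 2 := by
    field_simp
  rw [h4, h5] at h3
  exact le_of_sq_le_sq (by linarith) (by positivity)

theorem exists_tendsto_of_summable {W : ℕ → E →L[ℂ] E} (hW : Summable W) {M : ℝ}
    (h : ∀ m, ‖∑ k ∈ Finset.range (m + 1), W k‖ ≤ M) :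
    ∃ L : E →L[ℂ] E, Tendsto (fun m => ∑ k ∈ Finset.range m, W k) atTop (𝓝 L) ∧ ‖L‖ ≤ M := by
  have ht := hW.hasSum.tendsto_sum_nat
  refine ⟨_, ht, le_of_tendsto ((tendsto_add_atTop_iff_nat 1).mpr ht).norm ?_⟩
  exact Eventually.of_forall h

variable [CompleteSpace E]

theorem inner_self_mul_self_apply {R : E →L[ℂ] E} (hR : IsSelfAdjoint R) (x : E) :
    inner ℂ x ((R * R) x) = ((‖R x‖ ^ 2 : ℝ) : ℂ) := by
  have h := ContinuousLinearMap.adjoint_inner_left R (R x) x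
  rw [← ContinuousLinearMap.star_eq_adjoint, hR.star_eq] at h
  rw [mul_apply_eq_comp, ← h]
  simp [inner_self_eq_norm_sq_to_K]

/-- Substituting `D⁻¹ x` and `D⁻¹ y` turns the bound into the criterion for `D⁻¹ A D⁻¹` to be a
contraction. -/
theorem exists_contraction_factor {A D : E →L[ℂ] E} (hD : IsSelfAdjoint D) (hu : IsUnit D)
    (h : ∀ x y : E, (inner ℂ y (A x)).re ≤ 1 / 2 * (‖D x‖ ^ 2 + ‖D y‖ ^ 2)) :
    ∃ G : E →L[ℂ] E, ‖G‖ ≤ 1 ∧ A = D * G * D := by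
  obtain ⟨U, rfl⟩ := hu
  refine ⟨↑U⁻¹ * A * ↑U⁻¹, norm_le_of_re_inner_le one_pos fun x y => ?_, by simp [mul_assoc]⟩
  have hUU : ∀ z, (U : E →L[ℂ] E) ((↑U⁻¹ : E →L[ℂ] E) z) = z := fun z => by
    rw [← mul_apply_eq_comp, Units.mul_inv]
    rfl
  have hy := h ((↑U⁻¹ : E →L[ℂ] E) x) ((↑U⁻¹ : E →L[ℂ] E) y)
  rw [hUU, hUU] at hy
  have e : inner ℂ y ((↑U⁻¹ * A * ↑U⁻¹ : E →L[ℂ] E) x)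
      = inner ℂ ((↑U⁻¹ : E →L[ℂ] E) y) (A ((↑U⁻¹ : E →L[ℂ] E) x)) := by
    conv_lhs => rw [← hUU y]
    rw [← hD.star_eq, ContinuousLinearMap.star_eq_adjoint, ContinuousLinearMap.adjoint_inner_left,
      mul_apply_eq_comp, mul_apply_eq_comp, hUU]
  rw [e]
  exact hy

/-- The form is at most `‖Rx‖‖Ry‖ + ½‖Qx‖‖Qy‖`. By `2ab ≤ a² + b²` and the identity for `R² + Q²/2`,
this is at most `M/2 (‖x‖² + ‖y‖²)`. -/
theorem norm_sandwich_add_le {R Q C Z : E →L[ℂ] E} {M : ℝ} (hM : 0 < M) (hR : IsSelfAdjoint R)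
    (hQ : IsSelfAdjoint Q) (hRQ : R * R + (1 / 2 : ℂ) • (Q * Q) = (M : ℂ) • 1)
    (hC : ‖C‖ ≤ 1) (hZ : ‖Z‖ ≤ 1 / 2) : ‖R * C * R + Q * Z * Q‖ ≤ M := by
  refine norm_le_of_re_inner_le hM fun x y => ?_
  have hn : ∀ z : E, ‖R z‖ ^ 2 + 1 / 2 * ‖Q z‖ ^ 2 = M * ‖z‖ ^ 2 := by
    intro z
    have h := congrArg (fun S : E →L[ℂ] E => (inner ℂ z (S z)).re) hRQ
    have hl : inner ℂ z ((R * R + (1 / 2 : ℂ) • (Q * Q)) z)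
        = ((‖R z‖ ^ 2 + 1 / 2 * ‖Q z‖ ^ 2 : ℝ) : ℂ) := by
      rw [add_apply, inner_add_right, smul_apply, inner_smul_right,
        inner_self_mul_self_apply hR, inner_self_mul_self_apply hQ]
      push_cast
      ring
    have hr : inner ℂ z (((M : ℂ) • (1 : E →L[ℂ] E)) z) = ((M * ‖z‖ ^ 2 : ℝ) : ℂ) := by
      rw [smul_apply, inner_smul_right, one_apply_eq_self, inner_self_eq_norm_sq_to_K]
      simp
    simp only [hl, hr, Complex.ofReal_re] at h
    exact h
  have hsand : ∀ {P B : E →L[ℂ] E} {c : ℝ}, IsSelfAdjoint P → ‖B‖ ≤ c →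
      (inner ℂ y ((P * B * P) x)).re ≤ c * (‖P x‖ * ‖P y‖) := by
    intro P B c hP hB
    have e : inner ℂ y ((P * B * P) x) = inner ℂ (P y) (B (P x)) := by
      conv_rhs => rw [← hP.star_eq, ContinuousLinearMap.star_eq_adjoint,
        ContinuousLinearMap.adjoint_inner_left, ← ContinuousLinearMap.star_eq_adjoint, hP.star_eq]
      rfl
    rw [e]
    calc (inner ℂ (P y) (B (P x))).re ≤ ‖inner ℂ (P y) (B (P x))‖ := Complex.re_le_norm _
      _ ≤ ‖P y‖ * ‖B (P x)‖ := norm_inner_le_norm _ _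
      _ ≤ ‖P y‖ * (c * ‖P x‖) := by gcongr; exact B.le_of_opNorm_le hB _
      _ = c * (‖P x‖ * ‖P y‖) := by ring
  rw [add_apply, inner_add_right, Complex.add_re]
  have h1 := hsand hR hC
  have h2 := hsand hQ hZ
  nlinarith [hn x, hn y, sq_nonneg (‖R x‖ - ‖R y‖), sq_nonneg (‖Q x‖ - ‖Q y‖)]

theorem norm_le_sqrt_of_star_mul_self_le {Z B : E →L[ℂ] E} (h : star Z * Z ≤ B) :
    ‖Z‖ ≤ √‖B‖ := by
  refine Real.le_sqrt_of_sq_le ?_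
  rw [pow_two, ← CStarRing.norm_star_mul_self]
  exact CStarAlgebra.norm_le_norm_of_nonneg_of_le (star_mul_self_nonneg Z) h

theorem star_mul_self_le_one_of_norm_le_one {G : E →L[ℂ] E} (h : ‖G‖ ≤ 1) : star G * G ≤ 1 := by
  refine (CStarAlgebra.norm_le_one_iff_of_nonneg _ (star_mul_self_nonneg G)).mp ?_
  rw [CStarRing.norm_star_mul_self]
  exact mul_le_one₀ h (norm_nonneg _) h

theorem smul_one_nonneg {ε : ℝ} (hε : 0 ≤ ε) : 0 ≤ (ε : ℂ) • (1 : E →L[ℂ] E) := by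
  rw [Complex.coe_smul]
  exact smul_nonneg hε zero_le_one

theorem isUnit_add_smul_one {B : E →L[ℂ] E} (hB : 0 ≤ B) {ε : ℝ} (hε : 0 < ε) :
    IsUnit (B + (ε : ℂ) • 1) := by
  refine CStarAlgebra.isUnit_of_le ((ε : ℂ) • (1 : E →L[ℂ] E)) (le_add_of_nonneg_left hB) ?_
  refine IsStrictlyPositive.iff_of_unital.mpr ⟨smul_one_nonneg hε.le, ?_⟩
  exact (isUnit_one (M := E →L[ℂ] E)).smul (Units.mk0 (ε : ℂ) (by exact_mod_cast hε.ne'))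

theorem star_sum_mul_sum {ι : Type*} {s : Finset ι} {T : ι → E →L[ℂ] E}
    (h : ∀ i ∈ s, ∀ j ∈ s, i ≠ j → star (T i) * T j = 0) :
    star (∑ i ∈ s, T i) * ∑ i ∈ s, T i = ∑ i ∈ s, star (T i) * T i := by
  rw [star_sum, Finset.sum_mul]
  refine Finset.sum_congr rfl fun i hi => ?_
  rw [Finset.mul_sum]
  exact Finset.sum_eq_single_of_mem i hi fun j hj hne => h i hi j hj hne.symm

theorem norm_sum_sandwich_le {R Q C : E →L[ℂ] E} {W Z : ℕ → E →L[ℂ] E} {M : ℝ} (hM : 0 < M)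
    (hR : IsSelfAdjoint R) (hQ : IsSelfAdjoint Q)
    (hRQ : R * R + (1 / 2 : ℂ) • (Q * Q) = (M : ℂ) • 1) (hC : ‖C‖ ≤ 1)
    (h0 : W 0 = R * C * R) (hW : ∀ k, W (k + 1) = Q * Z k * Q) {m : ℕ}
    (hZ : ∑ k ∈ Finset.range m, ‖Z k‖ ≤ 1 / 2) : ‖∑ k ∈ Finset.range (m + 1), W k‖ ≤ M := by
  rw [Finset.sum_range_succ', add_comm, h0]
  simp only [hW]
  rw [← Finset.sum_mul, ← Finset.mul_sum]
  exact norm_sandwich_add_le hM hR hQ hRQ hC ((norm_sum_le _ _).trans hZ)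

theorem summable_of_sandwich {Q : E →L[ℂ] E} {W Z : ℕ → E →L[ℂ] E} {y : ℕ → ℝ}
    (hW : ∀ k, W (k + 1) = Q * Z k * Q) (hZ : ∀ k, ‖Z k‖ ≤ y k) (hy : Summable y) :
    Summable W := by
  rw [← summable_nat_add_iff 1]
  refine Summable.of_norm_bounded ((hy.mul_left ‖Q‖).mul_right ‖Q‖) fun k => ?_
  rw [hW]
  refine (norm_mul_le _ _).trans ?_
  gcongr
  refine (norm_mul_le _ _).trans ?_
  gcongr
  exact hZ k

end hilbert

/-! ### Factorization of the coefficients and bounds on homogeneous parts -/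

section fock

variable {n : ℕ} {H : Type*} [NormedAddCommGroup H] [InnerProductSpace ℂ H]
  {K : Type*} [NormedAddCommGroup K] [InnerProductSpace ℂ K]

/-- The homogeneous part `∑_{|α| = k} S_α ⊗ A_(α) ⊗ Y_(α)`. -/
def homogeneousPart (A : Words n → H →L[ℂ] H) (Y : Words n → K →L[ℂ] K) (k : ℕ) :
    HTensor (HTensor (Fock n) H) K →L[ℂ] HTensor (HTensor (Fock n) H) K :=
  ∑ α ∈ wordsOfLength n k, opTensor (opTensor (wordProd leftCreation α) (A α)) (Y α)

theorem homogeneousPart_eq_sandwich {A G : Words n → H →L[ℂ] H} {D : H →L[ℂ] H} {k : ℕ}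
    (hAG : ∀ α ∈ wordsOfLength n k, A α = D * G α * D) (Y : Words n → K →L[ℂ] K) :
    homogeneousPart A Y k = opTensor (opTensor (1 : Fock n →L[ℂ] Fock n) D) 1
      * homogeneousPart G Y k * opTensor (opTensor 1 D) 1 := by
  rw [homogeneousPart, homogeneousPart, Finset.mul_sum, Finset.sum_mul]
  refine Finset.sum_congr rfl fun α hα => ?_
  rw [← opTensor_mul, ← opTensor_mul, ← opTensor_mul, ← opTensor_mul, hAG α hα]
  simp only [one_mul, mul_one]

theorem homogeneousPart_zero (A : Words n → H →L[ℂ] H) (Y : Words n → K →L[ℂ] K) :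
    homogeneousPart A Y 0 = opTensor (opTensor 1 (A 1)) (Y 1) := by
  have : wordsOfLength n 0 = {1} := by
    ext α
    rw [mem_wordsOfLength, FreeMonoid.length_eq_zero, Finset.mem_singleton]
  rw [homogeneousPart, this, Finset.sum_singleton, wordProd_one]

variable [CompleteSpace H] [CompleteSpace K]

/-- Orthogonality of the ranges of the `S_α` removes the cross terms of `Z* Z`, leaving `∑ I ⊗ G_α*
G_α ⊗ Y_α* Y_α ≤ I ⊗ ∑ Y_α* Y_α`. -/
theorem norm_homogeneousPart_le {G : Words n → H →L[ℂ] H} {k : ℕ}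
    (hG : ∀ α ∈ wordsOfLength n k, ‖G α‖ ≤ 1) (Y : Words n → K →L[ℂ] K) :
    ‖homogeneousPart G Y k‖ ≤ √‖∑ α ∈ wordsOfLength n k, star (Y α) * Y α‖ := by
  have hstar : star (homogeneousPart G Y k) * homogeneousPart G Y k
      = ∑ α ∈ wordsOfLength n k,
        opTensor (opTensor (1 : Fock n →L[ℂ] Fock n) (star (G α) * G α)) (star (Y α) * Y α) := by
    rw [homogeneousPart, star_sum_mul_sum]
    · refine Finset.sum_congr rfl fun α hα => ?_
      rw [star_opTensor, star_opTensor, ← opTensor_mul, ← opTensor_mul,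
        star_wordProd_leftCreation_mul rfl, if_pos rfl]
    · intro α hα β hβ hne
      rw [star_opTensor, star_opTensor, ← opTensor_mul, ← opTensor_mul,
        star_wordProd_leftCreation_mul
          ((mem_wordsOfLength.mp hα).trans (mem_wordsOfLength.mp hβ).symm),
        if_neg hne, opTensor_zero_left, opTensor_zero_left]
  have hle : star (homogeneousPart G Y k) * homogeneousPart G Y k
      ≤ opTensor 1 (∑ α ∈ wordsOfLength n k, star (Y α) * Y α) := by
    rw [hstar, opTensor_sum_right]
    refine Finset.sum_le_sum fun α hα => ?_
    refine opTensor_le_opTensor_left ?_ (star_mul_self_nonneg (Y α))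
    calc opTensor (1 : Fock n →L[ℂ] Fock n) (star (G α) * G α)
        ≤ opTensor 1 1 := opTensor_le_opTensor_right zero_le_one
          (star_mul_self_le_one_of_norm_le_one (hG α hα))
      _ = 1 := opTensor_one
  refine (norm_le_sqrt_of_star_mul_self_le hle).trans (Real.sqrt_le_sqrt ?_)
  refine (norm_opTensor_le _ _).trans (mul_le_of_le_one_left (norm_nonneg _) ?_)
  exact ContinuousLinearMap.norm_id_le

theorem isSelfAdjoint_opTensor {E F : Type*} [NormedAddCommGroup E] [InnerProductSpace ℂ E]
    [CompleteSpace E] [NormedAddCommGroup F] [InnerProductSpace ℂ F] [CompleteSpace F]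
    {S : E →L[ℂ] E} {B : F →L[ℂ] F} (hS : IsSelfAdjoint S) (hB : IsSelfAdjoint B) :
    IsSelfAdjoint (opTensor S B) := by
  rw [IsSelfAdjoint, star_opTensor, hS.star_eq, hB.star_eq]

variable {A : Words n → H →L[ℂ] H}

/-- The hypothesis `hre` says that the form of `A_(α)` is dominated by that of `I - A_(0)`. The
summand `ε` makes `D` invertible and only weakens the bound. -/
theorem exists_factorization (h0 : A 1 ≤ 1)
    (hre : ∀ α ≠ 1, ∀ x y : H, (inner ℂ x (A 1 x)).re + (inner ℂ y (A 1 y)).re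
      + (inner ℂ y (A α x)).re ≤ ‖x‖ ^ 2 + ‖y‖ ^ 2) {ε : ℝ} (hε : 0 < ε) :
    ∃ (D : H →L[ℂ] H) (G : Words n → H →L[ℂ] H), IsSelfAdjoint D ∧
      D * D = (2 : ℂ) • (1 - A 1) + (ε : ℂ) • 1 ∧ (∀ α, ‖G α‖ ≤ 1) ∧
      ∀ α ≠ 1, A α = D * G α * D := by
  have hB : 0 ≤ (2 : ℂ) • (1 - A 1) := by
    rw [two_smul]
    exact add_nonneg (sub_nonneg.mpr h0) (sub_nonneg.mpr h0)
  have hu := isUnit_add_smul_one hB hε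
  set P := (2 : ℂ) • (1 - A 1) + (ε : ℂ) • 1 with hP
  have hP0 : 0 ≤ P := add_nonneg hB (smul_one_nonneg hε.le)
  have hsa : IsSelfAdjoint (CFC.sqrt P) := (CFC.sqrt_nonneg P).isSelfAdjoint
  have hsq : CFC.sqrt P * CFC.sqrt P = P := CFC.sqrt_mul_sqrt_self P
  have hnorm : ∀ x, ‖CFC.sqrt P x‖ ^ 2
      = 2 * (‖x‖ ^ 2 - (inner ℂ x (A 1 x)).re) + ε * ‖x‖ ^ 2 := by
    intro x
    have h1 := inner_self_mul_self_apply hsa x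
    have h2 : inner ℂ x (P x) = 2 * (inner ℂ x x - inner ℂ x (A 1 x)) + (ε : ℂ) * inner ℂ x x := by
      rw [← inner_sub_right, ← inner_smul_right, ← inner_smul_right, ← inner_add_right]
      rfl
    rw [hsq, h2] at h1
    have h3 := congrArg Complex.re h1
    rw [Complex.ofReal_re] at h3
    rw [← h3, inner_self_eq_norm_sq_to_K]
    simp [← Complex.ofReal_pow]
  have hex : ∀ α, ∃ G : H →L[ℂ] H, ‖G‖ ≤ 1 ∧ (α ≠ 1 → A α = CFC.sqrt P * G * CFC.sqrt P) := by
    intro α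
    by_cases hα : α = 1
    · exact ⟨0, by simp, fun h => absurd hα h⟩
    · obtain ⟨G, hG, hAG⟩ := exists_contraction_factor (A := A α) hsa
        ((CFC.isUnit_sqrt_iff P hP0).mpr hu) fun x y => by
          rw [hnorm, hnorm]
          nlinarith [hre α hα x y, mul_nonneg hε.le (sq_nonneg ‖x‖), mul_nonneg hε.le (sq_nonneg ‖y‖)]
      exact ⟨G, hG, fun _ => hAG⟩
  choose G hG hAG using hex
  exact ⟨CFC.sqrt P, G, hsa, hsq, hG, hAG⟩

theorem norm_sum_homogeneousPart_le (hpos : 0 ≤ A 1) (h0 : A 1 ≤ 1)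
    (hre : ∀ α ≠ 1, ∀ x y : H, (inner ℂ x (A 1 x)).re + (inner ℂ y (A 1 y)).re
      + (inner ℂ y (A α x)).re ≤ ‖x‖ ^ 2 + ‖y‖ ^ 2)
    (Y : Words n → K →L[ℂ] K) (hY : ‖Y 1‖ ≤ 1) (m : ℕ)
    (hsum : ∑ k ∈ Finset.range m, √‖∑ α ∈ wordsOfLength n (k + 1), star (Y α) * Y α‖ ≤ 1 / 2) :
    ‖∑ k ∈ Finset.range (m + 1), homogeneousPart A Y k‖ ≤ 1 := by
  refine le_of_forall_pos_le_add fun δ hδ => ?_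
  -- With `ε = 2δ`, `A_(0) + D²/2 = (1 + δ) I`.
  obtain ⟨D, G, hD, hDD, hG, hAG⟩ := exists_factorization h0 hre (mul_pos two_pos hδ)
  have hR : IsSelfAdjoint (CFC.sqrt (A 1)) := (CFC.sqrt_nonneg (A 1)).isSelfAdjoint
  have hRR : CFC.sqrt (A 1) * CFC.sqrt (A 1) = A 1 := CFC.sqrt_mul_sqrt_self (A 1)
  have e0 : homogeneousPart A Y 0 = opTensor (opTensor 1 (CFC.sqrt (A 1))) 1
      * opTensor 1 (Y 1) * opTensor (opTensor 1 (CFC.sqrt (A 1))) 1 := by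
    rw [homogeneousPart_zero, ← opTensor_mul, ← opTensor_mul, mul_one, ← opTensor_mul, hRR]
    simp only [one_mul, mul_one]
  have e1 : ∀ k, homogeneousPart A Y (k + 1) = opTensor (opTensor (1 : Fock n →L[ℂ] Fock n) D) 1
      * homogeneousPart G Y (k + 1) * opTensor (opTensor 1 D) 1 := fun k =>
    homogeneousPart_eq_sandwich (fun α hα => hAG α (by
      rintro rfl
      simp [mem_wordsOfLength] at hα)) Y
  refine norm_sum_sandwich_le (by positivity) ?_ ?_ ?_ ?_ e0 e1 ?_
  · exact isSelfAdjoint_opTensor (isSelfAdjoint_opTensor (.one _) hR) (.one _)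
  · exact isSelfAdjoint_opTensor (isSelfAdjoint_opTensor (.one _) hD) (.one _)
  · rw [← opTensor_mul, ← opTensor_mul, ← opTensor_mul, ← opTensor_mul, hRR, hDD]
    simp only [one_mul, opTensor_add_right, opTensor_add_left, opTensor_smul_right,
      opTensor_smul_left, opTensor_sub_right, opTensor_sub_left, opTensor_one]
    module
  · refine (norm_opTensor_le _ _).trans ?_
    exact mul_le_one₀ ContinuousLinearMap.norm_id_le (norm_nonneg _) hY
  · refine le_trans (Finset.sum_le_sum fun k _ => ?_) hsum
    exact norm_homogeneousPart_le (fun α _ => hG α) Y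

theorem summable_homogeneousPart (h0 : A 1 ≤ 1)
    (hre : ∀ α ≠ 1, ∀ x y : H, (inner ℂ x (A 1 x)).re + (inner ℂ y (A 1 y)).re
      + (inner ℂ y (A α x)).re ≤ ‖x‖ ^ 2 + ‖y‖ ^ 2)
    (Y : Words n → K →L[ℂ] K)
    (hs : Summable fun k : ℕ => √‖∑ α ∈ wordsOfLength n (k + 1), star (Y α) * Y α‖) :
    Summable (homogeneousPart A Y) := by
  obtain ⟨D, G, hD, hDD, hG, hAG⟩ := exists_factorization h0 hre one_pos
  refine summable_of_sandwich (fun k => homogeneousPart_eq_sandwich (fun α hα => hAG α ?_) Y)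
    (fun k => norm_homogeneousPart_le (fun α _ => hG α) Y) hs
  rintro rfl
  simp [mem_wordsOfLength] at hα

end fock

end FreeHolo

end

/-! ### The main theorem -/

theorem theorem2p4 (n : ℕ)
    {H : Type u} [NormedAddCommGroup H] [InnerProductSpace ℂ H] [CompleteSpace H]
    (A : FreeHolo.Words n → H →L[ℂ] H)
    (hA : FreeHolo.IsHolomorphic.{w} A)
    (hA0 : ∀ (X : Type w) [NormedAddCommGroup X] [InnerProductSpace ℂ X] [CompleteSpace X],
      0 ≤ FreeHolo.eval A (0 : Fin n → X →L[ℂ] X))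
    (hARe : ∀ (X : Type w) [NormedAddCommGroup X] [InnerProductSpace ℂ X] [CompleteSpace X]
      (T : Fin n → X →L[ℂ] X), FreeHolo.InBall T →
        (realPart (FreeHolo.eval A T) :
          FreeHolo.HTensor X H →L[ℂ] FreeHolo.HTensor X H) ≤ 1) :
    (∀ k : ℕ, 1 ≤ k → 0 ≤ FreeHolo.blockOp (FreeHolo.matP A k)) ∧
    (∀ {K : Type v} [NormedAddCommGroup K] [InnerProductSpace ℂ K] [CompleteSpace K]
      (Y : FreeHolo.Words n → K →L[ℂ] K),
      ‖Y 1‖ ≤ 1 →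
      Summable (fun k : ℕ =>
        √‖∑ α ∈ FreeHolo.wordsOfLength n (k + 1), star (Y α) * Y α‖) →
      ∑' k : ℕ, √‖∑ α ∈ FreeHolo.wordsOfLength n (k + 1), star (Y α) * Y α‖ ≤ 1 / 2 →
      ∃ L : FreeHolo.HTensor (FreeHolo.HTensor (FreeHolo.Fock n) H) K →L[ℂ]
          FreeHolo.HTensor (FreeHolo.HTensor (FreeHolo.Fock n) H) K,
        Tendsto (fun m : ℕ => ∑ k ∈ Finset.range m, ∑ α ∈ FreeHolo.wordsOfLength n k,
          FreeHolo.opTensor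
            (FreeHolo.opTensor (FreeHolo.wordProd FreeHolo.leftCreation α) (A α)) (Y α))
          atTop (𝓝 L) ∧ ‖L‖ ≤ 1) := by
  refine ⟨fun k hk => FreeHolo.blockOp_matP_nonneg hA hA0 hARe hk, ?_⟩
  intro K _ _ _ Y hY hs hle
  have hpos := FreeHolo.coeff_one_nonneg hA hA0
  have hself : ∀ x : H, (inner ℂ x x).re = ‖x‖ ^ 2 := fun x => inner_self_eq_norm_sq (𝕜 := ℂ) x
  have hre : ∀ α ≠ 1, ∀ x y : H, (inner ℂ x (A 1 x)).re + (inner ℂ y (A 1 y)).re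
      + (inner ℂ y (A α x)).re ≤ ‖x‖ ^ 2 + ‖y‖ ^ 2 := by
    intro α hα x y
    have hk : 1 ≤ α.length := by
      rw [Nat.one_le_iff_ne_zero, Ne, FreeMonoid.length_eq_zero]
      exact hα
    let μ₀ : FreeHolo.wordsOfLength n α.length := ⟨α, FreeHolo.mem_wordsOfLength.mpr rfl⟩
    -- A family supported at the single word `α` keeps only the `2 × 2` block of `A_(α)`.
    have h := FreeHolo.re_inner_coeff_le hA hARe hk x (Pi.single μ₀ y)
    rw [Finset.sum_eq_single_of_mem μ₀ (Finset.mem_univ _),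
      Finset.sum_eq_single_of_mem μ₀ (Finset.mem_univ _),
      Finset.sum_eq_single_of_mem μ₀ (Finset.mem_univ _), Pi.single_eq_same, hself, hself] at h
    · exact h
    all_goals
      intro μ _ hμ
      simp [Pi.single_eq_of_ne hμ]
  have h0 : A 1 ≤ 1 := by
    rw [ContinuousLinearMap.le_def]
    rw [ContinuousLinearMap.isPositive_def']
    refine ⟨(IsSelfAdjoint.one _).sub hpos.isSelfAdjoint, fun x => ?_⟩
    -- With a zero family only the vacuum entry remains; `k = 1` is an arbitrary choice.
    have h := FreeHolo.re_inner_coeff_le hA hARe le_rfl x 0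
    simp only [Pi.zero_apply, inner_zero_left, Complex.zero_re, Finset.sum_const_zero, add_zero]
      at h
    rw [ContinuousLinearMap.reApplyInnerSelf_apply, inner_re_symm, sub_apply, inner_sub_right,
      map_sub, sub_nonneg]
    exact h
  exact FreeHolo.exists_tendsto_of_summable (FreeHolo.summable_homogeneousPart h0 hre Y hs)
    fun m => FreeHolo.norm_sum_homogeneousPart_le hpos h0 hre Y hY m
      ((hs.sum_le_tsum _ fun _ _ => Real.sqrt_nonneg _).trans hle)
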